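/- The boundary value problem $$y''-y'+y=y^3\quad(-\infty<x<\infty),\qquad y(0)=0,\qquad \lim_{x\to\infty}y(x)=1,\qquad y(x)>0\ \text{ for } 0<x<\infty$$ has a unique twice differentiable solution $y^*:\mathbb R\to\mathbb R$. Put $$a^*=(y^*)'(0),\qquad b^*=\int_{-\infty}^0 e^{-s/2}\cos\Big(\tfrac{\sqrt3}{2}s\Big)\,y^*(s)^3\,ds,\qquad c^*=\int_{-\infty}^0 e^{-s/2}\sin\Big(\tfrac{\sqrt3}{2}s\Big)\,y^*(s)^3\,ds,$$ $$d^*=\int_0^\infty e^{s}\Big((1-y^*(s))^2-\tfrac13(1-y^*(s))^3\Big)\,ds.$$ These integrals converge absolutely, $a^*\neq0$, $a^*-b^*\ne 0$, and $y^*$ has the following asymptotics. (i) As $x\to-\infty$, $$y^*(x)=A\,e^{x/2}\sin\Big(\tfrac{\sqrt3}{2}x+\phi\Big)+O\big(e^{3x/2}\big),\qquad A=\frac{2}{\sqrt3}\sqrt{(a^*-b^*)^2+(c^*)^2},\qquad \phi=\arctan\frac{c^*}{a^*-b^*}.$$ (ii) As $x\to0$, $y^*(x)\sim a^*x$. (iii)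 As $x\to\infty$, $$y^*(x)=1-B\,e^{-x}+O\big(e^{-2x}\big),\qquad B=\frac{2+a^*}{3}+d^*.$$ -/

import Mathlib

open MeasureTheory Filter Topology Asymptotics Set

/-- `y : ℝ → ℝ` is a (classical, globally defined) solution of the boundary value problem
`y'' - y' + y = y³` on `ℝ`, `y(0) = 0`, `y(∞) = 1`, `y(x) > 0` for `0 < x < ∞`. -/
structure IsSolutionP (y : ℝ → ℝ) : Prop where
  differentiable : Differentiable ℝ y
  differentiable_deriv : Differentiable ℝ (deriv y)
  ode : ∀ x : ℝ, deriv (deriv y) x - deriv y x + y x = y x ^ 3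
  zero : y 0 = 0
  tendsto_one : Tendsto y atTop (𝓝 1)
  pos : ∀ x : ℝ, 0 < x → 0 < y x

/-- The integrand `e^{-s/2} cos(√3 s / 2) y(s)³`. -/
noncomputable def bIntegrand (y : ℝ → ℝ) (s : ℝ) : ℝ :=
  Real.exp (-s / 2) * Real.cos (Real.sqrt 3 / 2 * s) * y s ^ 3

/-- The integrand `e^{-s/2} sin(√3 s / 2) y(s)³`. -/
noncomputable def cIntegrand (y : ℝ → ℝ) (s : ℝ) : ℝ :=
  Real.exp (-s / 2) * Real.sin (Real.sqrt 3 / 2 * s) * y s ^ 3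

/-- The integrand `e^s ((1 - y(s))² - (1 - y(s))³ / 3)`. -/
noncomputable def dIntegrand (y : ℝ → ℝ) (s : ℝ) : ℝ :=
  Real.exp s * ((1 - y s) ^ 2 - 1 / 3 * (1 - y s) ^ 3)

/-- `a = y'(0)`. -/
noncomputable def aConst (y : ℝ → ℝ) : ℝ := deriv y 0

/-- `b = ∫_{-∞}^0 e^{-s/2} cos(√3 s / 2) y(s)³ ds`. -/
noncomputable def bConst (y : ℝ → ℝ) : ℝ := ∫ s in Iic (0 : ℝ), bIntegrand y s

/-- `c = ∫_{-∞}^0 e^{-s/2} sin(√3 s / 2) y(s)³ ds`. -/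
noncomputable def cConst (y : ℝ → ℝ) : ℝ := ∫ s in Iic (0 : ℝ), cIntegrand y s

/-- `d = ∫_0^∞ e^s ((1 - y(s))² - (1 - y(s))³ / 3) ds`. -/
noncomputable def dConst (y : ℝ → ℝ) : ℝ := ∫ s in Ioi (0 : ℝ), dIntegrand y s

/-- The amplitude `A = (2/√3) √((a - b)² + c²)`. -/
noncomputable def amplitude (y : ℝ → ℝ) : ℝ :=
  2 / Real.sqrt 3 * Real.sqrt ((aConst y - bConst y) ^ 2 + cConst y ^ 2)

/-- The phase `φ = arctan (c / (a - b))`. -/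
noncomputable def phase (y : ℝ → ℝ) : ℝ :=
  Real.arctan (cConst y / (aConst y - bConst y))

/-- The coefficient `B = (2 + a)/3 + d`. -/
noncomputable def BConst (y : ℝ → ℝ) : ℝ := (2 + aConst y) / 3 + dConst y

/-! Existence is by shooting in the phase plane `y' = p`, `p' = p - y + y³`, started at `(0, a)`
with `a > 0`. Truncating the field makes every trajectory global. The slopes that overshoot `1` and
those that turn back below `1` form disjoint open sets. Both meet `(0, ∞)`, so by connectedness some
positive slope lies in neither (`exists_slope`). Its orbit increases below `1` for `x ≥ 0`, while
the Lyapunov function `lyapunov` confines it for `x ≤ 0`. The truncation is therefore never active,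
and the orbit solves the original equation (`exists_isProfile`).

Uniqueness is a Sturm-type comparison. For two solutions, `e^{-x}(z'y - y'z)` has derivative `e^{-x}
y z (z² - y²)`. If `z` starts steeper, then `z / y` stays above `1` and never decreases, so it
cannot tend to `1` (`not_slope_lt`). It then suffices to prove the asymptotics for the orbit found
by shooting.

At `+∞` the equilibrium `(1, 0)` has eigenvalues `2` and `-1`. Since the orbit stays bounded, the
unstable coordinate `p - (1 - y)` is quadratically small in `1 - y`. The stable coordinate `p + 2(1
- y)`, multiplied by `e^x / 3`, has derivative exactly `dIntegrand`, which gives `B`.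

At `-∞` the orbit spirals into the origin, with eigenvalues `1/2 ± i√3/2`. Variation of constants
gives two coefficients whose derivatives are, up to sign, `bIntegrand` and `cIntegrand`. The bound
`|y| = O(e^{x/2})` makes these derivatives `O(e^x)`, so the coefficients converge to `a - b` and
`c`. The arctangent gives the correct phase only if `a - b > 0`; `le_sinCoeff` supplies this. -/

/-! ### Global integral curves and one-variable calculus -/

/-- A bounded, globally Lipschitz autonomous vector field has integral curves defined on `ℝ`. -/
theorem exists_global_integral_curve {E : Type*} [NormedAddCommGroup E] [NormedSpace ℝ E]
    [CompleteSpace E] {V : E → E} {K L : NNReal} (hK : LipschitzWith K V) (hL : ∀ z, ‖V z‖ ≤ L)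
    (z : E) : ∃ γ : ℝ → E, γ 0 = z ∧ ∀ t, HasDerivAt γ (V (γ t)) t := by
  have key (n : ℕ) : ∃ α : ℝ → E, α 0 = z ∧ ∀ t ∈ Icc (-(n + 1 : ℝ)) (n + 1),
      HasDerivWithinAt α (V (α t)) (Icc (-(n + 1 : ℝ)) (n + 1)) t := by
    have hn : (0 : ℝ) ≤ n + 1 := by positivity
    have hPL : IsPicardLindelof (fun _ ↦ V) (tmin := -(n + 1 : ℝ)) (tmax := n + 1)
        ⟨0, by linarith, hn⟩ z (L * (n + 1)) 0 L K :=
      .of_time_independent (fun x _ ↦ hL x) hK.lipschitzOnWith (by simp)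
    exact hPL.exists_eq_forall_mem_Icc_hasDerivWithinAt₀
  choose α hα0 hα using key
  have hder (n : ℕ) (t : ℝ) (ht : t ∈ Ioo (-(n + 1 : ℝ)) (n + 1)) :
      HasDerivAt (α n) (V (α n t)) t :=
    (hα n t (Ioo_subset_Icc_self ht)).hasDerivAt (Icc_mem_nhds ht.1 ht.2)
  have huniq {n m : ℕ} (hnm : n ≤ m) : EqOn (α n) (α m) (Icc (-(n + 1 : ℝ)) (n + 1)) := by
    have hnm' : (n : ℝ) ≤ m := by exact_mod_cast hnm
    have hn : (0 : ℝ) < n + 1 := by positivity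
    have hsub : Icc (-(n + 1 : ℝ)) (n + 1) ⊆ Icc (-(m + 1 : ℝ)) (m + 1) :=
      Icc_subset_Icc (by linarith) (by linarith)
    refine ODE_solution_unique_of_mem_Icc (v := fun _ ↦ V) (s := fun _ ↦ univ) (K := K) (t₀ := 0)
      (fun _ _ ↦ hK.lipschitzOnWith) ⟨by linarith, hn⟩
      (fun t ht ↦ (hα n t ht).continuousWithinAt) (fun t ht ↦ hder n t ht) (fun _ _ ↦ mem_univ _)
      (fun t ht ↦ ((hα m t (hsub ht)).mono hsub).continuousWithinAt)
      (fun t ht ↦ hder m t ⟨by linarith [ht.1], by linarith [ht.2]⟩) (fun _ _ ↦ mem_univ _) ?_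
    rw [hα0, hα0]
  refine ⟨fun t ↦ α ⌈|t|⌉₊ t, by simp [hα0], fun t ↦ ?_⟩
  have hmem (s : ℝ) : s ∈ Icc (-((⌈|s|⌉₊ : ℝ) + 1)) ((⌈|s|⌉₊ : ℝ) + 1) := by
    have := Nat.le_ceil |s|
    exact ⟨by linarith [neg_abs_le s], by linarith [le_abs_self s]⟩
  -- The index `⌈|t|⌉₊` may jump at `t`; one more unit gives a single curve that agrees with the
  -- glued one on a whole neighbourhood of `t`.
  set N := ⌈|t|⌉₊ + 1 with hN
  have htN : |t| < N := by
    have := Nat.le_ceil |t|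
    rw [hN]; push_cast; linarith
  have heq : (fun s ↦ α ⌈|s|⌉₊ s) =ᶠ[𝓝 t] α N := by
    filter_upwards [continuous_abs.continuousAt.eventually (Iio_mem_nhds htN)] with s hs
    exact huniq (Nat.ceil_le.2 (le_of_lt hs)) (hmem s)
  have h1 := abs_lt.1 htN
  have := (hder N t ⟨by linarith, by linarith⟩).congr_of_eventuallyEq heq
  convert this using 2
  exact heq.eq_of_nhds

theorem le_of_hasDerivAt_nonneg {f f' : ℝ → ℝ} {a b : ℝ} (hab : a ≤ b)
    (hf : ∀ x ∈ Icc a b, HasDerivAt f (f' x) x) (h0 : ∀ x ∈ Ioo a b, 0 ≤ f' x) : f a ≤ f b := by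
  refine monotoneOn_of_hasDerivWithinAt_nonneg (f' := f') (convex_Icc a b)
    (fun x hx ↦ (hf x hx).continuousAt.continuousWithinAt)
    (fun x hx ↦ (hf x (interior_subset hx)).hasDerivWithinAt) (fun x hx ↦ h0 x ?_)
    (left_mem_Icc.2 hab) (right_mem_Icc.2 hab) hab
  simpa using hx

theorem le_of_hasDerivAt_nonpos {f f' : ℝ → ℝ} {a b : ℝ} (hab : a ≤ b)
    (hf : ∀ x ∈ Icc a b, HasDerivAt f (f' x) x) (h0 : ∀ x ∈ Ioo a b, f' x ≤ 0) : f b ≤ f a := by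
  have := le_of_hasDerivAt_nonneg hab (f := fun x ↦ -f x) (f' := fun x ↦ -f' x)
    (fun x hx ↦ (hf x hx).neg) (fun x hx ↦ by linarith [h0 x hx])
  linarith

/-- A continuous function that is positive at `a` and not positive somewhere to the right of `a`
has a first zero to the right of `a`. -/
theorem exists_first_zero {f : ℝ → ℝ} (hf : Continuous f) {a b : ℝ} (ha : 0 < f a) (hab : a ≤ b)
    (hb : f b ≤ 0) : ∃ c, a < c ∧ c ≤ b ∧ f c = 0 ∧ ∀ x ∈ Ico a c, 0 < f x := by
  set S := Icc a b ∩ f ⁻¹' Iic 0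
  have hS : IsClosed S := isClosed_Icc.inter (isClosed_Iic.preimage hf)
  have hbd : BddBelow S := ⟨a, fun x hx ↦ hx.1.1⟩
  have hc : sInf S ∈ S := hS.csInf_mem ⟨b, ⟨hab, le_rfl⟩, hb⟩ hbd
  have hlt : ∀ x ∈ Ico a (sInf S), 0 < f x := fun x hx ↦ by
    by_contra h
    exact absurd (csInf_le hbd ⟨⟨hx.1, hx.2.le.trans hc.1.2⟩, not_lt.1 h⟩) (not_le.2 hx.2)
  have hac : a < sInf S := hc.1.1.lt_of_ne fun h ↦ by
    have : f (sInf S) ≤ 0 := hc.2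
    rw [← h] at this; linarith
  refine ⟨sInf S, hac, hc.1.2, le_antisymm hc.2 ?_, hlt⟩
  refine ge_of_tendsto (x := 𝓝[<] sInf S) (hf.continuousAt.mono_left nhdsWithin_le_nhds) ?_
  filter_upwards [Ioo_mem_nhdsLT hac] with x hx using (hlt x ⟨hx.1.le, hx.2⟩).le

theorem eventually_lt_right_of_hasDerivAt_pos {f : ℝ → ℝ} {f' a : ℝ} (hf : HasDerivAt f f' a)
    (h : 0 < f') : ∀ᶠ x in 𝓝[>] a, f a < f x := by
  have := (hasDerivAt_iff_tendsto_slope.1 hf).mono_left (nhdsGT_le_nhdsNE a)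
  filter_upwards [this.eventually (lt_mem_nhds h), self_mem_nhdsWithin] with x hx hxa
  have hxa : 0 < x - a := sub_pos.2 hxa
  rw [slope_def_field, lt_div_iff₀ hxa] at hx
  linarith

/-- A function with positive derivative wherever it takes the value `m` does not cross `m` downwards. -/
theorem le_of_barrier {f f' : ℝ → ℝ} {a m : ℝ} (hf : ∀ x, HasDerivAt f (f' x) x) (ha : m ≤ f a)
    (h : ∀ x, f x = m → 0 < f' x) : ∀ x, a ≤ x → m ≤ f x := by
  intro x hx
  exact image_le_of_deriv_right_lt_deriv_boundary' (f := fun _ ↦ m) (f' := fun _ ↦ 0) (B := f) (B' := f')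
    (a := a) (b := x) continuousOn_const (fun _ _ ↦ (hasDerivAt_const _ _).hasDerivWithinAt) ha
    (fun y _ ↦ (hf y).continuousAt.continuousWithinAt) (fun y _ ↦ (hf y).hasDerivWithinAt)
    (fun y _ hy ↦ h y hy.symm) ⟨hx, le_rfl⟩

/-! ### The truncated phase-plane system -/

/-- Truncation of a real number to `[-M, M]`. -/
noncomputable def clip (M z : ℝ) : ℝ := max (-M) (min M z)

theorem abs_clip_le {M : ℝ} (hM : 0 ≤ M) (z : ℝ) : |clip M z| ≤ M := by
  rw [abs_le]
  exact ⟨le_max_left _ _, max_le (by linarith) (min_le_left _ _)⟩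

theorem clip_eq_self {M z : ℝ} (h : |z| ≤ M) : clip M z = z := by
  rw [abs_le] at h
  rw [clip, min_eq_right h.2, max_eq_right h.1]

theorem abs_clip_sub_clip_le (M z w : ℝ) : |clip M z - clip M w| ≤ |z - w| := by
  refine (abs_max_sub_max_le_max (-M) (min M z) (-M) (min M w)).trans (max_le (by simp) ?_)
  exact (abs_min_sub_min_le_max M z M w).trans (by simp)

theorem min_le_clip {M z : ℝ} : min M z ≤ clip M z := le_max_right _ _

/-- The phase-plane vector field of `y'' - y' + y = y³`, truncated to be bounded. -/
noncomputable def truncField (z : ℝ × ℝ) : ℝ × ℝ :=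
  (clip 2 z.2, clip 2 z.2 - clip 1 z.1 + clip 1 z.1 ^ 3)

theorem norm_truncField_le (z : ℝ × ℝ) : ‖truncField z‖ ≤ (4 : NNReal) := by
  have h1 := abs_clip_le (M := 2) (by norm_num) z.2
  have h2 := abs_clip_le (M := 1) (by norm_num) z.1
  set p := clip 2 z.2
  set y := clip 1 z.1
  simp only [truncField, Prod.norm_def, Real.norm_eq_abs]
  rw [abs_le] at h1 h2
  refine max_le (abs_le.2 ⟨?_, ?_⟩) (abs_le.2 ⟨?_, ?_⟩)
  · push_cast; linarith
  · push_cast; linarith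
  all_goals
    push_cast
    nlinarith [mul_nonneg (sub_nonneg.2 h2.1) (sub_nonneg.2 h2.2), sq_nonneg y]

theorem lipschitzWith_truncField : LipschitzWith 5 truncField := by
  refine LipschitzWith.of_dist_le_mul fun z w ↦ ?_
  have hp := abs_clip_sub_clip_le 2 z.2 w.2
  have hy := abs_clip_sub_clip_le 1 z.1 w.1
  have h1 := abs_le.1 (abs_clip_le (M := 1) (by norm_num) z.1)
  have h2 := abs_le.1 (abs_clip_le (M := 1) (by norm_num) w.1)
  simp only [truncField, Prod.dist_eq, Real.dist_eq]
  set p := clip 2 z.2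
  set q := clip 2 w.2
  set y := clip 1 z.1
  set x := clip 1 w.1
  have hm1 := le_max_left |z.1 - w.1| |z.2 - w.2|
  have hm2 := le_max_right |z.1 - w.1| |z.2 - w.2|
  have hm0 := abs_nonneg (z.1 - w.1)
  set m := max |z.1 - w.1| |z.2 - w.2|
  have hq : |y ^ 2 + y * x + x ^ 2 - 1| ≤ 4 := by
    rw [abs_le]; constructor <;> nlinarith [sq_nonneg (y + x), sq_nonneg (y - x)]
  have e : p - y + y ^ 3 - (q - x + x ^ 3) = (p - q) + (y ^ 2 + y * x + x ^ 2 - 1) * (y - x) := by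
    ring
  have e2 : |p - y + y ^ 3 - (q - x + x ^ 3)| ≤ |p - q| + 4 * |y - x| := by
    rw [e]
    refine (abs_add_le _ _).trans ?_
    rw [abs_mul]
    gcongr
  push_cast
  exact max_le (by linarith) (by linarith)

/-- `(y, p)` is the trajectory of the truncated system starting at `(0, a)`. -/
structure IsTruncSol (a : ℝ) (y p : ℝ → ℝ) : Prop where
  hasDerivAt_fst : ∀ x, HasDerivAt y (clip 2 (p x)) x
  hasDerivAt_snd : ∀ x, HasDerivAt p (clip 2 (p x) - clip 1 (y x) + clip 1 (y x) ^ 3) x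
  fst_zero : y 0 = 0
  snd_zero : p 0 = a

theorem exists_isTruncSol (a : ℝ) : ∃ y p, IsTruncSol a y p := by
  obtain ⟨γ, h0, hγ⟩ := exists_global_integral_curve lipschitzWith_truncField norm_truncField_le (0, a)
  refine ⟨fun x ↦ (γ x).1, fun x ↦ (γ x).2, fun x ↦ ?_, fun x ↦ ?_, by simp [h0], by simp [h0]⟩
  · exact (hasFDerivAt_fst (𝕜 := ℝ)).comp_hasDerivAt x (hγ x)
  · exact (hasFDerivAt_snd (𝕜 := ℝ)).comp_hasDerivAt x (hγ x)

namespace IsTruncSol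
variable {a b : ℝ} {y p z q : ℝ → ℝ}

theorem hasDerivAt_prodMk (h : IsTruncSol a y p) (x : ℝ) :
    HasDerivAt (fun x ↦ (y x, p x)) (truncField (y x, p x)) x :=
  (h.hasDerivAt_fst x).prodMk (h.hasDerivAt_snd x)

theorem continuous_fst (h : IsTruncSol a y p) : Continuous y :=
  continuous_iff_continuousAt.2 fun x ↦ (h.hasDerivAt_fst x).continuousAt

theorem continuous_snd (h : IsTruncSol a y p) : Continuous p :=
  continuous_iff_continuousAt.2 fun x ↦ (h.hasDerivAt_snd x).continuousAt

theorem dist_le (h : IsTruncSol a y p) (h' : IsTruncSol b z q) {x : ℝ} (hx : 0 ≤ x) :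
    |y x - z x| ≤ |a - b| * Real.exp (5 * x) ∧ |p x - q x| ≤ |a - b| * Real.exp (5 * x) := by
  have := dist_le_of_trajectories_ODE (v := fun _ ↦ truncField) (K := 5) (a := 0) (b := x)
    (δ := |a - b|) (f := fun x ↦ (y x, p x)) (g := fun x ↦ (z x, q x))
    (fun _ ↦ lipschitzWith_truncField)
    (fun t _ ↦ (h.hasDerivAt_prodMk t).continuousAt.continuousWithinAt)
    (fun t _ ↦ (h.hasDerivAt_prodMk t).hasDerivWithinAt)
    (fun t _ ↦ (h'.hasDerivAt_prodMk t).continuousAt.continuousWithinAt)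
    (fun t _ ↦ (h'.hasDerivAt_prodMk t).hasDerivWithinAt)
    (by simp [Prod.dist_eq, Real.dist_eq, h.fst_zero, h'.fst_zero, h.snd_zero, h'.snd_zero])
    x ⟨hx, le_rfl⟩
  simpa [Prod.dist_eq, Real.dist_eq] using this

/-- `(1, 0)` is an equilibrium, so by uniqueness a trajectory through it would be constant, against
`y 0 = 0`. -/
theorem not_rest (h : IsTruncSol a y p) (x : ℝ) : ¬ (y x = 1 ∧ p x = 0) := by
  rintro ⟨hy, hp⟩
  have hc (t : ℝ) : HasDerivAt (fun _ : ℝ ↦ ((1 : ℝ), (0 : ℝ))) (truncField (1, 0)) t := by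
    have : truncField (1, 0) = 0 := by simp [truncField, clip]
    rw [this]
    exact hasDerivAt_const _ _
  have := ODE_solution_unique_univ (v := fun _ ↦ truncField) (s := fun _ ↦ univ) (K := 5) (t₀ := x)
    (fun _ ↦ lipschitzWith_truncField.lipschitzOnWith)
    (fun t ↦ ⟨h.hasDerivAt_prodMk t, mem_univ _⟩) (fun t ↦ ⟨hc t, mem_univ _⟩) (by simp [hy, hp])
  have h0 := congrArg Prod.fst (congrFun this 0)
  simp [h.fst_zero] at h0

/-- On `[-1, 1]` the minimum of `c³ - c` is `-2/(3√3) > -1/2`, so `p' > 0` whenever `p = 1/2`. The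
number `3/5` below approximates the minimiser `1/√3`. -/
theorem half_le_snd (h : IsTruncSol a y p) {x₀ : ℝ} (h0 : 1 / 2 ≤ p x₀) :
    ∀ x, x₀ ≤ x → 1 / 2 ≤ p x := by
  refine le_of_barrier h.hasDerivAt_snd h0 fun x hx ↦ ?_
  have h1 := abs_le.1 (abs_clip_le (M := 1) (by norm_num) (y x))
  rw [hx, clip_eq_self (by rw [abs_le]; norm_num : |(1 / 2 : ℝ)| ≤ 2)]
  set c := clip 1 (y x)
  nlinarith [sq_nonneg (c - 3 / 5), mul_nonneg (sub_nonneg.2 h1.1) (sq_nonneg (c - 3 / 5))]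

theorem exists_one_lt (h : IsTruncSol a y p) {x₀ : ℝ} (h0 : 1 / 2 ≤ p x₀) :
    ∃ x, x₀ ≤ x ∧ 1 < y x := by
  have hp := h.half_le_snd h0
  -- Since `y` grows at rate at least `1/2`, this length of time gains `|y x₀| + 2`.
  have hn : 0 ≤ 2 * |y x₀| + 4 := by positivity
  have := le_of_hasDerivAt_nonneg (f := fun x ↦ y x - x / 2) (a := x₀)
    (b := x₀ + (2 * |y x₀| + 4)) (by linarith)
    (fun x _ ↦ (h.hasDerivAt_fst x).sub ((hasDerivAt_id x).div_const 2)) fun x hx ↦ by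
      have : (1 / 2 : ℝ) ≤ clip 2 (p x) :=
        le_trans (le_min (by norm_num) (hp x hx.1.le)) min_le_clip
      linarith
  refine ⟨x₀ + (2 * |y x₀| + 4), by linarith, ?_⟩
  have := neg_abs_le (y x₀)
  linarith

theorem monotone_of_snd_nonneg (h : IsTruncSol a y p) {u v : ℝ} (huv : u ≤ v)
    (hp : ∀ x ∈ Ioo u v, 0 ≤ p x) : y u ≤ y v :=
  le_of_hasDerivAt_nonneg huv (fun x _ ↦ h.hasDerivAt_fst x) fun x hx ↦
    le_trans (le_min (by norm_num) (hp x hx)) min_le_clip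

theorem fst_pos (h : IsTruncSol a y p) (ha : 0 < a) {x : ℝ} (hx : 0 < x)
    (hp : ∀ s ∈ Ioo 0 x, 0 ≤ p s) : 0 < y x := by
  have hd := h.hasDerivAt_fst 0
  rw [h.snd_zero] at hd
  have hpos : 0 < clip 2 a := lt_of_lt_of_le (lt_min (by norm_num) ha) min_le_clip
  have hev := eventually_lt_right_of_hasDerivAt_pos hd hpos
  obtain ⟨s, hs, hs0, hsx⟩ := (hev.and (Ioo_mem_nhdsGT hx)).exists
  rw [h.fst_zero] at hs
  exact hs.trans_le (h.monotone_of_snd_nonneg hsx.le fun t ht ↦ hp t ⟨hs0.trans ht.1, ht.2⟩)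

end IsTruncSol

/-! ### Shooting: overshooting and turning slopes -/

/-- Initial slopes whose trajectory rises above `1` with positive slope throughout. -/
def overshootSet : Set ℝ :=
  {a | ∃ y p, IsTruncSol a y p ∧ ∃ x, 0 ≤ x ∧ 1 < y x ∧ ∀ s ∈ Icc 0 x, 0 < p s}

/-- Initial slopes whose trajectory starts to descend before reaching `1`. -/
def turnSet : Set ℝ :=
  {a | ∃ y p, IsTruncSol a y p ∧ ∃ x, 0 ≤ x ∧ p x < 0 ∧ ∀ s ∈ Icc 0 x, y s < 1}

namespace IsTruncSol
variable {a b : ℝ} {y p z q : ℝ → ℝ}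

theorem dist_lt (h : IsTruncSol a y p) (h' : IsTruncSol b z q) {x m s : ℝ}
    (hb : |a - b| < m * Real.exp (-(5 * x))) (hs : s ∈ Icc 0 x) :
    |y s - z s| < m ∧ |p s - q s| < m := by
  have h1 := h.dist_le h' hs.1
  have : |a - b| * Real.exp (5 * s) < m := by
    calc |a - b| * Real.exp (5 * s) ≤ |a - b| * Real.exp (5 * x) := by gcongr; exact hs.2
      _ < m * Real.exp (-(5 * x)) * Real.exp (5 * x) := by gcongr
      _ = m := by rw [mul_assoc, ← Real.exp_add]; simp
  exact ⟨h1.1.trans_lt this, h1.2.trans_lt this⟩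

theorem unique (h : IsTruncSol a y p) (h' : IsTruncSol a z q) {x : ℝ} (hx : 0 ≤ x) :
    y x = z x ∧ p x = q x := by
  have := h.dist_le h' hx
  simp only [sub_self, abs_zero, zero_mul, abs_nonpos_iff, sub_eq_zero] at this
  exact this

end IsTruncSol

/-- The strict inequalities hold with a uniform margin on the compact `[0, x]`. A change of slope
smaller than the margin times `e^{-5x}` preserves them by Grönwall. -/
theorem isOpen_overshootSet : IsOpen overshootSet := by
  rw [Metric.isOpen_iff]
  rintro a ⟨y, p, h, x, hx, hyx, hp⟩
  obtain ⟨t, ht, hmin⟩ := isCompact_Icc.exists_isMinOn (nonempty_Icc.2 hx) h.continuous_snd.continuousOn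
  have hm : 0 < min (p t) (y x - 1) := lt_min (hp t ht) (by linarith)
  refine ⟨min (p t) (y x - 1) * Real.exp (-(5 * x)), by positivity, fun b hb ↦ ?_⟩
  rw [Metric.mem_ball, dist_comm, Real.dist_eq] at hb
  obtain ⟨z, q, h'⟩ := exists_isTruncSol b
  refine ⟨z, q, h', x, hx, ?_, fun s hs ↦ ?_⟩
  · have := (h.dist_lt h' hb (right_mem_Icc.2 hx)).1
    linarith [(abs_lt.1 this).2, min_le_right (p t) (y x - 1)]
  · have := (h.dist_lt h' hb hs).2
    have h3 : p t ≤ p s := hmin hs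
    linarith [(abs_lt.1 this).2, min_le_left (p t) (y x - 1)]

theorem isOpen_turnSet : IsOpen turnSet := by
  rw [Metric.isOpen_iff]
  rintro a ⟨y, p, h, x, hx, hpx, hy⟩
  obtain ⟨t, ht, hmax⟩ := isCompact_Icc.exists_isMaxOn (nonempty_Icc.2 hx) h.continuous_fst.continuousOn
  have hm : 0 < min (1 - y t) (-p x) := lt_min (by linarith [hy t ht]) (by linarith)
  refine ⟨min (1 - y t) (-p x) * Real.exp (-(5 * x)), by positivity, fun b hb ↦ ?_⟩
  rw [Metric.mem_ball, dist_comm, Real.dist_eq] at hb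
  obtain ⟨z, q, h'⟩ := exists_isTruncSol b
  refine ⟨z, q, h', x, hx, ?_, fun s hs ↦ ?_⟩
  · have := (h.dist_lt h' hb (right_mem_Icc.2 hx)).2
    linarith [(abs_lt.1 this).1, min_le_right (1 - y t) (-p x)]
  · have := (h.dist_lt h' hb hs).1
    have h3 : y s ≤ y t := hmax hs
    linarith [(abs_lt.1 this).1, min_le_left (1 - y t) (-p x)]

theorem disjoint_overshootSet_turnSet : Disjoint overshootSet turnSet := by
  rw [Set.disjoint_left]
  rintro a ⟨y, p, h, x, hx, hyx, hp⟩ ⟨z, q, h', t, ht, hqt, hz⟩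
  rcases le_total x t with hxt | hxt
  · linarith [hz x ⟨hx, hxt⟩, (h.unique h' hx).1]
  · linarith [hp t ⟨ht, hxt⟩, (h.unique h' ht).2]

theorem one_mem_overshootSet : (1 : ℝ) ∈ overshootSet := by
  obtain ⟨y, p, h⟩ := exists_isTruncSol 1
  have h0 : 1 / 2 ≤ p 0 := by rw [h.snd_zero]; norm_num
  obtain ⟨x, hx, hyx⟩ := h.exists_one_lt h0
  exact ⟨y, p, h, x, hx, hyx, fun s hs ↦ by linarith [h.half_le_snd h0 s hs.1]⟩

/-- Small positive slopes turn back: compare with `exp (x / 2) * sin (x / 2)`. -/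
theorem exists_pos_mem_turnSet : ∃ a, 0 < a ∧ a ∈ turnSet := by
  have hpi := Real.pi_pos
  -- `T` is the first positive zero of `sin (x / 2)`. The slope below keeps the trajectory within
  -- `1/2` of the zero solution on `[0, T]`.
  set T := 2 * Real.pi with hT
  have hT0 : 0 < T := by positivity
  refine ⟨1 / 2 * Real.exp (-(5 * T)), by positivity, ?_⟩
  set a := 1 / 2 * Real.exp (-(5 * T)) with ha
  have ha0 : 0 < a := by positivity
  obtain ⟨y, p, h⟩ := exists_isTruncSol a
  have hzero : IsTruncSol 0 (fun _ ↦ 0) (fun _ ↦ 0) :=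
    ⟨fun x ↦ by simpa [clip] using hasDerivAt_const x (0 : ℝ),
      fun x ↦ by simpa [clip] using hasDerivAt_const x (0 : ℝ), rfl, rfl⟩
  have hsmall (x : ℝ) (hx : x ∈ Icc 0 T) : |y x| ≤ 1 / 2 ∧ |p x| ≤ 1 / 2 := by
    have h1 := h.dist_le hzero hx.1
    have : |a - 0| * Real.exp (5 * x) ≤ 1 / 2 := by
      rw [sub_zero, abs_of_pos ha0, ha, mul_assoc, ← Real.exp_add]
      have : Real.exp (-(5 * T) + 5 * x) ≤ 1 := Real.exp_le_one_iff.2 (by linarith [hx.2])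
      linarith
    simp only [sub_zero] at h1 this
    exact ⟨h1.1.trans this, h1.2.trans this⟩
  refine ⟨y, p, h, ?_⟩
  by_contra! hcon
  have hp (x : ℝ) (hx : x ∈ Icc 0 T) : 0 ≤ p x := by
    by_contra! hneg
    obtain ⟨s, hs, hys⟩ := hcon x hx.1 hneg
    linarith [(abs_le.1 (hsmall s ⟨hs.1, hs.2.trans hx.2⟩).1).2]
  have hyT : 0 < y T := h.fst_pos ha0 hT0 fun s hs ↦ hp s (Ioo_subset_Icc_self hs)
  have hypos (x : ℝ) (hx : x ∈ Icc 0 T) : 0 ≤ y x := by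
    have := h.monotone_of_snd_nonneg hx.1 fun s hs ↦ hp s ⟨hs.1.le, hs.2.le.trans hx.2⟩
    rwa [h.fst_zero] at this
  have hdE (x : ℝ) : HasDerivAt (fun x : ℝ ↦ Real.exp (-x / 2)) (-(1 / 2) * Real.exp (-x / 2)) x := by
    convert! ((hasDerivAt_id x).neg.div_const 2).exp using 1
    simp; ring
  have hdS (x : ℝ) : HasDerivAt (fun x : ℝ ↦ Real.sin (x / 2)) (1 / 2 * Real.cos (x / 2)) x := by
    convert! ((hasDerivAt_id x).div_const 2).sin using 1
    simp; ring
  have hdC (x : ℝ) : HasDerivAt (fun x : ℝ ↦ Real.cos (x / 2)) (-(1 / 2) * Real.sin (x / 2)) x := by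
    convert! ((hasDerivAt_id x).div_const 2).cos using 1
    simp; ring
  -- With `w = e^{x/2} sin (x/2)`, a solution of `w'' - w' + w/2 = 0`, this is the weighted
  -- Wronskian `e^{-x}(p w - w' y)`. It decreases because `y² ≤ 1/4 < 1/2`. It vanishes at `0`, yet
  -- equals `e^{-T/2} y(T) / 2 > 0` at `T`.
  have hW := le_of_hasDerivAt_nonpos hT0.le
    (f := fun x ↦ Real.exp (-x / 2) * (p x * Real.sin (x / 2)
      - (1 / 2 * Real.sin (x / 2) + 1 / 2 * Real.cos (x / 2)) * y x))
    (f' := fun x ↦ Real.exp (-x / 2) * Real.sin (x / 2) * y x * (y x ^ 2 - 1 / 2))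
    (fun x hx ↦ by
      obtain ⟨h1, h2⟩ := hsmall x hx
      have e1 := h.hasDerivAt_fst x
      have e2 := h.hasDerivAt_snd x
      rw [clip_eq_self (h2.trans (by norm_num))] at e1 e2
      rw [clip_eq_self (h1.trans (by norm_num))] at e2
      convert! (hdE x).mul ((e2.mul (hdS x)).sub
        ((((hdS x).const_mul (1 / 2)).add ((hdC x).const_mul (1 / 2))).mul e1)) using 1
      simp only [Pi.mul_apply, Pi.sub_apply, Pi.add_apply]
      ring)
    (fun x hx ↦ by
      have hx' := Ioo_subset_Icc_self hx
      have h1 := abs_le.1 (hsmall x hx').1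
      have h2 := hypos x hx'
      have hs : 0 ≤ Real.sin (x / 2) :=
        Real.sin_nonneg_of_nonneg_of_le_pi (by linarith [hx'.1]) (by linarith [hx'.2])
      refine mul_nonpos_of_nonneg_of_nonpos (by positivity) ?_
      nlinarith)
  have e1 : T / 2 = Real.pi := by rw [hT]; ring
  simp only [e1, Real.sin_pi, Real.cos_pi, h.fst_zero, zero_div, Real.sin_zero] at hW
  have := mul_pos (Real.exp_pos (-T / 2)) hyT
  linarith

theorem exists_slope : ∃ a, 0 < a ∧ a ∉ overshootSet ∧ a ∉ turnSet := by
  by_contra! hcon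
  obtain ⟨b, hb, hbt⟩ := exists_pos_mem_turnSet
  obtain ⟨x, -, hx⟩ := isPreconnected_Ioi (a := (0 : ℝ)) overshootSet turnSet isOpen_overshootSet
    isOpen_turnSet (fun a ha ↦ or_iff_not_imp_left.2 (hcon a ha)) ⟨1, mem_Ioi.2 one_pos, one_mem_overshootSet⟩
    ⟨b, hb, hbt⟩
  exact disjoint_overshootSet_turnSet.le_bot hx

/-- Consider the first time `X` at which `y = 1`. Before `X` the slope is nonnegative, as `a ∉
turnSet`. It cannot vanish there, since then `p' = y³ - y < 0` would force a turn. At `X` it is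
nonzero by `not_rest`, so the orbit crosses `1` with positive slope, against `a ∉ overshootSet`. -/
theorem IsTruncSol.fst_lt_one {a : ℝ} {y p : ℝ → ℝ} (h : IsTruncSol a y p) (ha : 0 < a)
    (hU : a ∉ overshootSet) (hD : a ∉ turnSet) : ∀ x, 0 ≤ x → y x < 1 := by
  intro b hb
  by_contra! hyb
  obtain ⟨X, hX0, -, hX, hlt⟩ := exists_first_zero (f := fun x ↦ 1 - y x)
    (continuous_const.sub h.continuous_fst) (by simp [h.fst_zero]) hb (by linarith)
  have hp0 (x : ℝ) (hx : x ∈ Ico 0 X) : 0 ≤ p x := by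
    by_contra! hneg
    exact hD ⟨y, p, h, x, hx.1, hneg, fun s hs ↦ by linarith [hlt s ⟨hs.1, hs.2.trans_lt hx.2⟩]⟩
  have hp1 (x : ℝ) (hx : x ∈ Ico 0 X) : 0 < p x := by
    refine (hp0 x hx).lt_of_ne fun hpx ↦ ?_
    rcases hx.1.eq_or_lt with rfl | hx0
    · linarith [h.snd_zero]
    have hy0 := h.fst_pos ha hx0 fun s hs ↦ hp0 s ⟨hs.1.le, hs.2.trans hx.2⟩
    have hy1 := hlt x hx
    have hd := (h.hasDerivAt_snd x).neg
    rw [← hpx, clip_eq_self (by simp : |(0 : ℝ)| ≤ 2),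
      clip_eq_self (by rw [abs_le]; constructor <;> linarith : |y x| ≤ 1)] at hd
    have hpos : 0 < -(0 - y x + y x ^ 3) := by
      have : 0 < y x * (1 - y x) * (1 + y x) := by positivity
      linarith
    obtain ⟨s, hs, hs1⟩ := ((eventually_lt_right_of_hasDerivAt_pos hd hpos).and
      (Ioo_mem_nhdsGT hx.2)).exists
    have := hp0 s ⟨hx.1.trans hs1.1.le, hs1.2⟩
    simp only [Pi.neg_apply] at hs
    linarith
  have hpX : 0 < p X := by
    have : 0 ≤ p X := by
      refine ge_of_tendsto (x := 𝓝[<] X) (h.continuous_snd.continuousAt.mono_left nhdsWithin_le_nhds) ?_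
      filter_upwards [Ioo_mem_nhdsLT hX0] with x hx using hp0 x ⟨hx.1.le, hx.2⟩
    exact this.lt_of_ne fun hpX ↦ h.not_rest X ⟨by linarith, hpX.symm⟩
  have hd := h.hasDerivAt_fst X
  have hpos : 0 < clip 2 (p X) := lt_of_lt_of_le (lt_min (by norm_num) hpX) min_le_clip
  have hev := h.continuous_snd.continuousAt.eventually (lt_mem_nhds hpX)
  obtain ⟨ε, hε, hball⟩ := Metric.eventually_nhds_iff_ball.1 hev
  obtain ⟨s, hs, hs1⟩ := ((eventually_lt_right_of_hasDerivAt_pos hd hpos).and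
      (Ioo_mem_nhdsGT (lt_add_of_pos_right X hε))).exists
  refine hU ⟨y, p, h, s, hX0.le.trans hs1.1.le, by linarith, fun t ht ↦ ?_⟩
  rcases lt_or_ge t X with htX | htX
  · exact hp1 t ⟨ht.1, htX⟩
  · refine hball t ?_
    rw [Real.ball_eq_Ioo]
    exact ⟨by linarith, by linarith [ht.2, hs1.2]⟩

/-! ### From the shooting orbit to a solution -/

/-- `(y, p)` is an orbit of `y' = p`, `p' = p - y + y³` with `y 0 = 0` that increases on `[0, ∞)`
without reaching `1`, together with the a priori bounds that such an orbit satisfies. -/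
structure IsProfile (y p : ℝ → ℝ) : Prop where
  hasDerivAt_fst : ∀ x, HasDerivAt y (p x) x
  hasDerivAt_snd : ∀ x, HasDerivAt p (p x - y x + y x ^ 3) x
  fst_zero : y 0 = 0
  slope_pos : 0 < p 0
  slope_le : p 0 ≤ 1 / 2
  fst_lt_one : ∀ x, 0 ≤ x → y x < 1
  snd_nonneg : ∀ x, 0 ≤ x → 0 ≤ p x
  snd_le : ∀ x, 0 ≤ x → p x ≤ 1 / 2
  sq_le : ∀ x, x ≤ 0 → y x ^ 2 ≤ 3 / 10

/-- The Lyapunov function of `y'' - y' + y = y³`, in terms of `y` and `p = y'`. -/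
noncomputable def lyapunov (y p : ℝ → ℝ) (x : ℝ) : ℝ :=
  (p x - y x) ^ 2 / 2 + y x ^ 2 / 2 - y x ^ 4 / 4

theorem hasDerivAt_lyapunov {y p : ℝ → ℝ} {x : ℝ} (hy : HasDerivAt y (p x) x)
    (hp : HasDerivAt p (p x - y x + y x ^ 3) x) :
    HasDerivAt (lyapunov y p) (y x ^ 2 * (1 - y x ^ 2)) x := by
  convert! ((((hp.sub hy).pow 2).div_const 2).add ((hy.pow 2).div_const 2)).sub
    ((hy.pow 4).div_const 4) using 1
  simp only [Pi.sub_apply]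
  push_cast
  ring

theorem sq_le_of_lyapunov_le {y p : ℝ → ℝ} {x : ℝ} (hy : |y x| ≤ 1)
    (h : lyapunov y p x ≤ 1 / 8) : y x ^ 2 ≤ 3 / 10 ∧ (p x - y x) ^ 2 ≤ 1 / 4 := by
  have h1 : y x ^ 2 ≤ 1 := (sq_le_one_iff_abs_le_one _).2 hy
  unfold lyapunov at h
  constructor
  · nlinarith [sq_nonneg (p x - y x)]
  · nlinarith [sq_nonneg (y x)]

/-- A continuation argument in backward time. Up to the first exit from the box `|y| < 1`, `|p| < 2`
the truncation is inactive, so the Lyapunov function stays below `a²/2 ≤ 1/8`. This forces `|y| <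
3/5` and `|p - y| ≤ 1/2`, so there is no exit. -/
theorem IsTruncSol.bounds_of_nonpos {a : ℝ} {y p : ℝ → ℝ} (h : IsTruncSol a y p) (ha : 0 < a)
    (ha' : a ≤ 1 / 2) : ∀ x, x ≤ 0 → |y x| < 1 ∧ |p x| < 2 := by
  intro b hb
  by_contra hcon
  -- Distance to the boundary of the box, with time reversed so that the exit becomes a first zero
  -- to the right.
  set f : ℝ → ℝ := fun x ↦ min (1 - |y (-x)|) (2 - |p (-x)|) with hf
  have hyc := h.continuous_fst
  have hpc := h.continuous_snd
  have hfc : Continuous f := by fun_prop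
  have hf0 : 0 < f 0 := by
    simp only [hf, neg_zero, h.fst_zero, h.snd_zero, abs_zero, abs_of_pos ha]
    exact lt_min (by norm_num) (by linarith)
  have hfb : f (-b) ≤ 0 := by
    simp only [hf, neg_neg]
    by_contra! hpos
    rw [lt_min_iff] at hpos
    exact hcon ⟨by linarith, by linarith⟩
  obtain ⟨X, hX0, -, hX, hlt⟩ := exists_first_zero hfc hf0 (by linarith) hfb
  have hin (x : ℝ) (hx : x ∈ Icc (-X) 0) : |y x| ≤ 1 ∧ |p x| ≤ 2 := by
    have : 0 ≤ f (-x) := by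
      rcases (show -x ≤ X by linarith [hx.1]).eq_or_lt with h1 | h1
      · rw [h1, hX]
      · exact (hlt (-x) ⟨by linarith [hx.2], h1⟩).le
    simp only [hf, neg_neg, le_min_iff] at this
    exact ⟨by linarith, by linarith⟩
  have hH := le_of_hasDerivAt_nonneg (f := lyapunov y p) (by linarith : -X ≤ 0)
    (fun x hx ↦ by
      obtain ⟨h1, h2⟩ := hin x hx
      have e1 := h.hasDerivAt_fst x
      have e2 := h.hasDerivAt_snd x
      rw [clip_eq_self h2] at e1 e2
      rw [clip_eq_self h1] at e2
      exact hasDerivAt_lyapunov e1 e2)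
    (fun x hx ↦ by
      have := (sq_le_one_iff_abs_le_one _).2 (hin x (Ioo_subset_Icc_self hx)).1
      exact mul_nonneg (sq_nonneg _) (by linarith))
  have h0 : lyapunov y p 0 ≤ 1 / 8 := by
    simp only [lyapunov, h.fst_zero, h.snd_zero]
    nlinarith
  obtain ⟨h1, -⟩ := hin (-X) ⟨le_rfl, by linarith⟩
  obtain ⟨h2, h3⟩ := sq_le_of_lyapunov_le h1 (hH.trans h0)
  have h4 : |y (-X)| < 3 / 5 := abs_lt_of_sq_lt_sq (by linarith) (by norm_num)
  have h5 : |p (-X) - y (-X)| ≤ 1 / 2 := abs_le_of_sq_le_sq (by linarith) (by norm_num)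
  have h6 : 0 < f X := by
    refine lt_min (by linarith) ?_
    rw [abs_lt] at h4
    rw [abs_le] at h5
    have : |p (-X)| < 2 := abs_lt.2 ⟨by linarith, by linarith⟩
    linarith
  linarith

theorem exists_isProfile : ∃ y p, IsProfile y p := by
  obtain ⟨a, ha, hU, hD⟩ := exists_slope
  obtain ⟨y, p, h⟩ := exists_isTruncSol a
  have hy1 := h.fst_lt_one ha hU hD
  have hp0 (x : ℝ) (hx : 0 ≤ x) : 0 ≤ p x := by
    by_contra! hneg
    exact hD ⟨y, p, h, x, hx, hneg, fun s hs ↦ hy1 s hs.1⟩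
  have hp1 (x : ℝ) (hx : 0 ≤ x) : p x ≤ 1 / 2 := by
    by_contra! hgt
    obtain ⟨s, hs, hys⟩ := h.exists_one_lt hgt.le
    linarith [hy1 s (hx.trans hs)]
  have hy0 (x : ℝ) (hx : 0 ≤ x) : 0 ≤ y x := by
    have := h.monotone_of_snd_nonneg hx fun s hs ↦ hp0 s hs.1.le
    rwa [h.fst_zero] at this
  have ha' : a ≤ 1 / 2 := h.snd_zero ▸ hp1 0 le_rfl
  have hbd (x : ℝ) : |y x| ≤ 1 ∧ |p x| ≤ 2 := by
    rcases le_total x 0 with hx | hx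
    · exact (h.bounds_of_nonpos ha ha' x hx).imp le_of_lt le_of_lt
    · exact ⟨abs_le.2 ⟨by linarith [hy0 x hx], (hy1 x hx).le⟩,
        abs_le.2 ⟨by linarith [hp0 x hx], by linarith [hp1 x hx]⟩⟩
  have hdy (x : ℝ) : HasDerivAt y (p x) x := by
    simpa only [clip_eq_self (hbd x).2] using h.hasDerivAt_fst x
  have hdp (x : ℝ) : HasDerivAt p (p x - y x + y x ^ 3) x := by
    simpa only [clip_eq_self (hbd x).2, clip_eq_self (hbd x).1] using h.hasDerivAt_snd x
  refine ⟨y, p, hdy, hdp, h.fst_zero, h.snd_zero ▸ ha, h.snd_zero ▸ ha', hy1, hp0, hp1, fun x hx ↦ ?_⟩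
  have hH := le_of_hasDerivAt_nonneg hx (fun x _ ↦ hasDerivAt_lyapunov (hdy x) (hdp x))
    (fun x _ ↦ by
      have := (sq_le_one_iff_abs_le_one _).2 (hbd x).1
      exact mul_nonneg (sq_nonneg _) (by linarith))
  have h0 : lyapunov y p 0 ≤ 1 / 8 := by
    simp only [lyapunov, h.fst_zero, h.snd_zero]
    nlinarith
  exact (sq_le_of_lyapunov_le (hbd x).1 (hH.trans h0)).1

namespace IsProfile
variable {y p : ℝ → ℝ}

theorem continuous_fst (h : IsProfile y p) : Continuous y :=
  continuous_iff_continuousAt.2 fun x ↦ (h.hasDerivAt_fst x).continuousAt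

theorem deriv_eq (h : IsProfile y p) : deriv y = p := funext fun x ↦ (h.hasDerivAt_fst x).deriv

theorem le_of_le (h : IsProfile y p) {u v : ℝ} (hu : 0 ≤ u) (huv : u ≤ v) : y u ≤ y v :=
  le_of_hasDerivAt_nonneg huv (fun x _ ↦ h.hasDerivAt_fst x) fun x hx ↦
    h.snd_nonneg x (hu.trans hx.1.le)

theorem fst_nonneg (h : IsProfile y p) {x : ℝ} (hx : 0 ≤ x) : 0 ≤ y x :=
  h.fst_zero ▸ h.le_of_le le_rfl hx

theorem fst_pos (h : IsProfile y p) {x : ℝ} (hx : 0 < x) : 0 < y x := by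
  obtain ⟨s, hs, hs0, hsx⟩ := ((eventually_lt_right_of_hasDerivAt_pos (h.hasDerivAt_fst 0)
    h.slope_pos).and (Ioo_mem_nhdsGT hx)).exists
  rw [h.fst_zero] at hs
  exact hs.trans_le (h.le_of_le hs0.le hsx.le)

/-- If `y` stayed below some `c < 1`, then `(p - y)' = -y(1 - y)(1 + y)` would be at most `-m` on
`[1, ∞)`. This contradicts the boundedness of `p - y`. -/
theorem tendsto_one (h : IsProfile y p) : Tendsto y atTop (𝓝 1) := by
  refine tendsto_order.2 ⟨fun c hc ↦ ?_, fun c hc ↦ ?_⟩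
  swap
  · filter_upwards [eventually_ge_atTop 0] with x hx using (h.fst_lt_one x hx).trans hc
  suffices ∃ x, 0 ≤ x ∧ c < y x by
    obtain ⟨x, hx, hcx⟩ := this
    filter_upwards [eventually_ge_atTop x] with t ht using hcx.trans_le (h.le_of_le hx ht)
  by_contra! hcon
  have hy1 := h.fst_pos one_pos
  set m := y 1 * (1 - c) with hm
  have hm0 : 0 < m := mul_pos hy1 (by linarith)
  have hN : 0 < 2 / m + 1 := by positivity
  have := le_of_hasDerivAt_nonpos (f := fun x ↦ p x - y x + m * x) (a := 1) (b := 1 + (2 / m + 1))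
    (by linarith)
    (fun x _ ↦ ((h.hasDerivAt_snd x).sub (h.hasDerivAt_fst x)).add ((hasDerivAt_id x).const_mul m))
    (fun x hx ↦ by
      have h1 := h.le_of_le zero_le_one hx.1.le
      have h2 := hcon x (by linarith [hx.1])
      have h3 : y 1 * (1 - c) ≤ y x * (1 - y x) :=
        mul_le_mul h1 (by linarith) (by linarith) (by linarith)
      have h4 : 0 ≤ y x * (1 - y x) * y x := by
        have := mul_pos hy1 (show 0 < 1 - c by linarith)
        exact mul_nonneg (by linarith) (by linarith)
      simp only [hm]
      nlinarith)
  have e : m * (1 + (2 / m + 1)) = 2 * m + 2 := by field_simp; ring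
  simp only [e] at this
  have b1 := h.fst_lt_one (1 + (2 / m + 1)) (by linarith)
  have b2 := h.snd_nonneg (1 + (2 / m + 1)) (by linarith)
  have b3 := h.snd_le 1 zero_le_one
  linarith

theorem isSolutionP (h : IsProfile y p) : IsSolutionP y where
  differentiable x := (h.hasDerivAt_fst x).differentiableAt
  differentiable_deriv x := by
    rw [h.deriv_eq]; exact (h.hasDerivAt_snd x).differentiableAt
  ode x := by
    rw [h.deriv_eq, (h.hasDerivAt_snd x).deriv]; ring
  zero := h.fst_zero
  tendsto_one := h.tendsto_one
  pos _ hx := h.fst_pos hx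

end IsProfile

/-! ### Uniqueness of the solution -/

namespace IsSolutionP
variable {y z : ℝ → ℝ}

theorem hasDerivAt (h : IsSolutionP y) (x : ℝ) : HasDerivAt y (deriv y x) x :=
  (h.differentiable x).hasDerivAt

theorem hasDerivAt_deriv (h : IsSolutionP y) (x : ℝ) :
    HasDerivAt (deriv y) (deriv y x - y x + y x ^ 3) x := by
  rw [show deriv y x - y x + y x ^ 3 = deriv (deriv y) x by linarith [h.ode x]]
  exact (h.differentiable_deriv x).hasDerivAt

theorem not_slope_lt (h : IsSolutionP y) (h' : IsSolutionP z) : ¬ deriv y 0 < deriv z 0 := by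
  intro hlt
  have hWd (x : ℝ) : HasDerivAt (fun x ↦ Real.exp (-x) * (deriv z x * y x - deriv y x * z x))
      (Real.exp (-x) * (y x * z x * (z x ^ 2 - y x ^ 2))) x := by
    convert! ((hasDerivAt_id x).neg.exp).mul (((h'.hasDerivAt_deriv x).mul (h.hasDerivAt x)).sub
      ((h.hasDerivAt_deriv x).mul (h'.hasDerivAt x))) using 1
    simp only [Pi.mul_apply, Pi.sub_apply, Pi.neg_apply, id]
    ring
  -- as long as `y ≤ z` on `[0, X]`, the ratio `z / y` is nondecreasing there
  have hratio {X u : ℝ} (hu : 0 < u) (huX : u ≤ X) (hle : ∀ s ∈ Ioo 0 X, y s ≤ z s) :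
      z u / y u ≤ z X / y X := by
    refine le_of_hasDerivAt_nonneg (f := fun x ↦ z x / y x) huX
      (fun x hx ↦ (h'.hasDerivAt x).div (h.hasDerivAt x) (h.pos x (hu.trans_le hx.1)).ne')
      fun x hx ↦ ?_
    have hx0 : 0 < x := hu.trans hx.1
    have hW := le_of_hasDerivAt_nonneg hx0.le (fun t _ ↦ hWd t) fun t ht ↦ by
      have h1 := h.pos t ht.1
      have h2 := h'.pos t ht.1
      have h3 := hle t ⟨ht.1, ht.2.trans hx.2⟩
      have h4 : 0 ≤ z t ^ 2 - y t ^ 2 := by nlinarith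
      positivity
    simp only [h.zero, h'.zero, mul_zero, sub_self] at hW
    have := nonneg_of_mul_nonneg_right hW (Real.exp_pos (-x))
    have hyx := h.pos x hx0
    refine div_nonneg ?_ (sq_nonneg _)
    linarith
  have hev := eventually_lt_right_of_hasDerivAt_pos ((h'.hasDerivAt 0).sub (h.hasDerivAt 0))
    (sub_pos.2 hlt)
  obtain ⟨ε, hε, hsub⟩ := mem_nhdsGT_iff_exists_Ioo_subset.1 hev
  have hε : 0 < ε := hε
  have hnear (s : ℝ) (hs : s ∈ Ioo 0 ε) : y s < z s := by
    have := hsub hs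
    simp only [mem_ofPred_eq, Pi.sub_apply, h.zero, h'.zero, sub_self] at this
    linarith
  -- At a first crossing the ratio `z / y` would be `1`, although it exceeds `1` at `ε / 2` and does
  -- not decrease in between.
  have hall (s : ℝ) (hs : 0 < s) : y s < z s := by
    rcases lt_or_ge s ε with hsε | hsε
    · exact hnear s ⟨hs, hsε⟩
    by_contra! hle
    have hu : ε / 2 ∈ Ioo 0 ε := ⟨by linarith, by linarith⟩
    obtain ⟨X, hX, -, hX0, hpos⟩ := exists_first_zero (f := fun x ↦ z x - y x)
      (h'.differentiable.continuous.sub h.differentiable.continuous) (sub_pos.2 (hnear _ hu))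
      (by linarith : ε / 2 ≤ s) (by linarith)
    have := hratio hu.1 hX.le fun t ht ↦ by
      rcases lt_or_ge t (ε / 2) with h1 | h1
      · exact (hnear t ⟨ht.1, by linarith⟩).le
      · linarith [hpos t ⟨h1, ht.2⟩]
    rw [sub_eq_zero.1 hX0, div_self (h.pos X (hu.1.trans hX)).ne', div_le_one (h.pos _ hu.1)] at this
    linarith [hnear _ hu]
  have hlim : Tendsto (fun x ↦ z x / y x) atTop (𝓝 (1 / 1)) :=
    h'.tendsto_one.div h.tendsto_one one_ne_zero
  have : z 1 / y 1 ≤ 1 / 1 := by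
    refine ge_of_tendsto hlim ?_
    filter_upwards [eventually_ge_atTop 1] with x hx
    exact hratio one_pos hx fun s hs ↦ (hall s hs.1).le
  rw [div_one, div_le_one (h.pos 1 one_pos)] at this
  linarith [hall 1 one_pos]

/-- Grönwall for the squared phase-plane distance `g`, run forwards or backwards from `0`. A bound
on `y² + yz + z²` over `[-|t|, |t|]` serves as the local Lipschitz constant of the cubic. -/
theorem eq_of_slope_eq (h : IsSolutionP y) (h' : IsSolutionP z) (heq : deriv y 0 = deriv z 0) :
    y = z := by
  have hy := h.differentiable.continuous
  have hz := h'.differentiable.continuous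
  ext t
  set T := |t|
  have hS : Continuous fun x ↦ y x ^ 2 + y x * z x + z x ^ 2 := by fun_prop
  obtain ⟨M, hM⟩ := (isCompact_Icc (a := -T) (b := T)).exists_bound_of_continuousOn hS.continuousOn
  simp only [Real.norm_eq_abs] at hM
  set g : ℝ → ℝ := fun x ↦ (y x - z x) ^ 2 + (deriv y x - deriv z x) ^ 2 with hg
  set g' : ℝ → ℝ := fun x ↦ 2 * (deriv y x - deriv z x) * ((deriv y x - deriv z x) +
    (y x ^ 2 + y x * z x + z x ^ 2) * (y x - z x)) with hg'
  have hgd (x : ℝ) : HasDerivAt g (g' x) x := by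
    convert! (((h.hasDerivAt x).sub (h'.hasDerivAt x)).pow 2).add
      (((h.hasDerivAt_deriv x).sub (h'.hasDerivAt_deriv x)).pow 2) using 1
    simp only [hg', Pi.sub_apply]
    push_cast
    ring
  have hg0 : g 0 = 0 := by simp [hg, h.zero, h'.zero, heq]
  have hgg (x : ℝ) (hx : x ∈ Icc (-T) T) : |g' x| ≤ (M + 2) * g x := by
    have hSx := hM x hx
    simp only [hg, hg']
    set u := y x - z x
    set v := deriv y x - deriv z x
    set S := y x ^ 2 + y x * z x + z x ^ 2
    have hM0 : 0 ≤ M := (abs_nonneg S).trans hSx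
    have h1 : |2 * v * (S * u)| ≤ M * (u ^ 2 + v ^ 2) := by
      have : 2 * v * (S * u) = S * (2 * u * v) := by ring
      rw [this, abs_mul]
      refine mul_le_mul hSx ?_ (abs_nonneg _) hM0
      rw [abs_le]; constructor <;> nlinarith [sq_nonneg (u + v), sq_nonneg (u - v)]
    have h2 : 2 * v * (v + S * u) = 2 * v ^ 2 + 2 * v * (S * u) := by ring
    rw [h2]
    refine (abs_add_le _ _).trans ?_
    rw [abs_of_nonneg (by positivity : 0 ≤ 2 * v ^ 2)]
    nlinarith [sq_nonneg u]
  have hexp (c x : ℝ) : HasDerivAt (fun x ↦ g x * Real.exp (c * x))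
      ((g' x + c * g x) * Real.exp (c * x)) x := by
    convert! (hgd x).mul ((hasDerivAt_id x).const_mul c).exp using 1
    simp
    ring
  have hgt : g t ≤ 0 := by
    rcases le_total 0 t with ht | ht
    · have := le_of_hasDerivAt_nonpos ht (fun x _ ↦ hexp (-(M + 2)) x) fun x hx ↦ by
        have h1 := (abs_le.1 (hgg x ⟨by linarith [hx.1, abs_nonneg t], hx.2.le.trans (le_abs_self t)⟩)).2
        exact mul_nonpos_of_nonpos_of_nonneg (by linarith) (Real.exp_pos _).le
      simp only [hg0, zero_mul] at this
      exact nonpos_of_mul_nonpos_left this (Real.exp_pos _)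
    · have := le_of_hasDerivAt_nonneg ht (fun x _ ↦ hexp (M + 2) x) fun x hx ↦ by
        have h1 := (abs_le.1 (hgg x ⟨(neg_abs_le t).trans hx.1.le, hx.2.le.trans (abs_nonneg t)⟩)).1
        exact mul_nonneg (by linarith) (Real.exp_pos _).le
      simp only [hg0, zero_mul] at this
      exact nonpos_of_mul_nonpos_left this (Real.exp_pos _)
  have : (y t - z t) ^ 2 ≤ 0 := by
    simp only [hg] at hgt
    linarith [sq_nonneg (deriv y t - deriv z t)]
  exact sub_eq_zero.1 (pow_eq_zero_iff (two_ne_zero)|>.1 (le_antisymm this (sq_nonneg _)))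

theorem unique (h : IsSolutionP y) (h' : IsSolutionP z) : y = z :=
  h.eq_of_slope_eq h' (le_antisymm (not_lt.1 (h'.not_slope_lt h)) (not_lt.1 (h.not_slope_lt h')))

end IsSolutionP

/-! ### Limits attained at an exponential rate -/

/-- If `F' = f` with `f = O(exp)` on `(-∞, 0]`, then `F` has an exponentially attained limit. -/
theorem integrableOn_Iic_and_abs_sub_le {F f : ℝ → ℝ} {K : ℝ} (hF : ∀ x, HasDerivAt F (f x) x)
    (hf : Continuous f) (hK : ∀ x ≤ 0, |f x| ≤ K * Real.exp x) :
    IntegrableOn f (Iic 0) ∧ ∀ x ≤ 0, |F x - (F 0 - ∫ s in Iic 0, f s)| ≤ K * Real.exp x := by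
  have hint : IntegrableOn f (Iic 0) :=
    ((integrableOn_exp_Iic 0).const_mul K).mono' hf.aestronglyMeasurable
      ((ae_restrict_iff' measurableSet_Iic).2 (.of_forall fun x hx ↦ hK x hx))
  refine ⟨hint, fun x hx ↦ ?_⟩
  have hsub : Iic x ⊆ Iic (0 : ℝ) := Iic_subset_Iic.2 hx
  have h1 := intervalIntegral.integral_Iic_sub_Iic (hint.mono_set hsub) hint
  rw [intervalIntegral.integral_eq_sub_of_hasDerivAt (fun t _ ↦ hF t) (hf.intervalIntegrable _ _)]
    at h1
  rw [show F x - (F 0 - ∫ s in Iic 0, f s) = ∫ s in Iic x, f s by linarith, ← integral_exp_Iic x,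
    ← integral_const_mul]
  exact norm_integral_le_of_norm_le (f := f) ((integrableOn_exp_Iic x).const_mul K)
    ((ae_restrict_iff' measurableSet_Iic).2 (.of_forall fun t ht ↦ hK t (hsub ht)))

theorem integrableOn_Ioi_and_abs_sub_le {F f : ℝ → ℝ} {K : ℝ} (hF : ∀ x, HasDerivAt F (f x) x)
    (hf : Continuous f) (hK : ∀ x, 0 ≤ x → |f x| ≤ K * Real.exp (-x)) :
    IntegrableOn f (Ioi 0) ∧
      ∀ x, 0 ≤ x → |F x - (F 0 + ∫ s in Ioi 0, f s)| ≤ K * Real.exp (-x) := by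
  have hint : IntegrableOn f (Ioi 0) :=
    ((integrableOn_exp_neg_Ioi 0).const_mul K).mono' hf.aestronglyMeasurable
      ((ae_restrict_iff' measurableSet_Ioi).2 (.of_forall fun x hx ↦ hK x (le_of_lt hx)))
  refine ⟨hint, fun x hx ↦ ?_⟩
  have hsub : Ioi x ⊆ Ioi (0 : ℝ) := Ioi_subset_Ioi hx
  have h1 := intervalIntegral.integral_interval_add_Ioi hint (hint.mono_set hsub)
  rw [intervalIntegral.integral_eq_sub_of_hasDerivAt (fun t _ ↦ hF t) (hf.intervalIntegrable _ _)]
    at h1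
  rw [show F x - (F 0 + ∫ s in Ioi 0, f s) = -∫ s in Ioi x, f s by linarith, abs_neg,
    ← integral_exp_neg_Ioi x, ← integral_const_mul]
  exact norm_integral_le_of_norm_le (f := f) ((integrableOn_exp_neg_Ioi x).const_mul K)
    ((ae_restrict_iff' measurableSet_Ioi).2 (.of_forall fun t ht ↦ hK t (le_of_lt (hsub ht))))

/-! ### Asymptotics at `+∞` -/

namespace IsProfile
variable {y p : ℝ → ℝ}

/-- `p - (1 - y)` is the unstable coordinate at `(1, 0)`, with eigenvalue `2`. The shift `k` serves
to dominate the quadratic forcing in the lower bound on `p`; the upper bound takes `k = 0`. -/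
theorem hasDerivAt_exp_mul (h : IsProfile y p) (k x : ℝ) :
    HasDerivAt (fun x ↦ Real.exp (-2 * x) * (p x - (1 - y x) + k))
      (Real.exp (-2 * x) * ((1 - y x) ^ 2 * (2 + y x) - 2 * k)) x := by
  convert! ((hasDerivAt_id x).const_mul (-2)).exp.mul
    (((h.hasDerivAt_snd x).sub ((h.hasDerivAt_fst x).const_sub 1)).add_const k) using 1
  simp only [id, Pi.sub_apply]
  ring

theorem tendsto_exp_neg_two_mul : Tendsto (fun x : ℝ ↦ Real.exp (-2 * x)) atTop (𝓝 0) :=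
  Real.tendsto_exp_atBot.comp (tendsto_id.const_mul_atTop_of_neg (by norm_num))

theorem snd_le_one_sub (h : IsProfile y p) {x : ℝ} (hx : 0 ≤ x) : p x - (1 - y x) ≤ 0 := by
  have hle : Real.exp (-2 * x) * (p x - (1 - y x)) ≤ 0 * (1 / 2) := by
    refine ge_of_tendsto (tendsto_exp_neg_two_mul.mul_const (1 / 2)) ?_
    filter_upwards [eventually_ge_atTop x] with t ht
    have := le_of_hasDerivAt_nonneg ht (fun s _ ↦ h.hasDerivAt_exp_mul 0 s) fun s hs ↦ by
      have := h.fst_nonneg (hx.trans hs.1.le)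
      have : 0 ≤ (1 - y s) ^ 2 * (2 + y s) - 2 * 0 := by
        rw [mul_zero, sub_zero]; positivity
      positivity
    simp only [add_zero] at this
    refine this.trans (mul_le_mul_of_nonneg_left ?_ (Real.exp_pos _).le)
    linarith [h.snd_le t (hx.trans ht), h.fst_lt_one t (hx.trans ht)]
  rw [zero_mul] at hle
  by_contra! hpos
  linarith [mul_pos (Real.exp_pos (-2 * x)) hpos]

theorem one_sub_sub_le (h : IsProfile y p) {x : ℝ} (hx : 0 ≤ x) :
    (1 - y x) - 3 / 2 * (1 - y x) ^ 2 ≤ p x := by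
  -- For `s ≥ x` the forcing `(1 - y s)²(2 + y s)` is at most `3(1 - y x)² = 2k`, so the weighted
  -- quantity is nonincreasing; its limit is at least `0`.
  set k := 3 / 2 * (1 - y x) ^ 2 with hk
  have hle : 0 * (-1) ≤ Real.exp (-2 * x) * (p x - (1 - y x) + k) := by
    refine le_of_tendsto (tendsto_exp_neg_two_mul.mul_const (-1)) ?_
    filter_upwards [eventually_ge_atTop x] with t ht
    have := le_of_hasDerivAt_nonpos ht (fun s _ ↦ h.hasDerivAt_exp_mul k s) fun s hs ↦ by
      have h0 := h.fst_nonneg hx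
      have h1 := h.le_of_le hx hs.1.le
      have h2 := h.fst_lt_one s (hx.trans hs.1.le)
      have : (1 - y s) ^ 2 * (2 + y s) ≤ (1 - y x) ^ 2 * 3 := by
        refine mul_le_mul (pow_le_pow_left₀ (by linarith) (by linarith) 2) (by linarith) (by linarith)
          (sq_nonneg _)
      exact mul_nonpos_of_nonneg_of_nonpos (Real.exp_pos _).le (by rw [hk]; linarith)
    refine (mul_le_mul_of_nonneg_left ?_ (Real.exp_pos _).le).trans this
    have : 0 ≤ k := by positivity
    linarith [h.snd_nonneg t (hx.trans ht), h.fst_nonneg (hx.trans ht)]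
  rw [zero_mul] at hle
  linarith [nonneg_of_mul_nonneg_right hle (Real.exp_pos _)]

/-- `u = 1 - y` satisfies the Riccati inequality `u' ≤ -u + (3/2)u²`. The quantity `e^x u / (1 -
(3/2)u)` is constant in the equality case, hence nonincreasing here once `u < 1/3`. -/
theorem exists_one_sub_le (h : IsProfile y p) :
    ∃ C, 0 < C ∧ ∀ x, 0 ≤ x → 1 - y x ≤ C * Real.exp (-x) := by
  obtain ⟨X, hX⟩ := eventually_atTop.1
    ((h.tendsto_one.eventually (lt_mem_nhds (show (2 / 3 : ℝ) < 1 by norm_num))).and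
      (eventually_ge_atTop 0))
  have hX0 := (hX X le_rfl).2
  have hpos (x : ℝ) (hx : X ≤ x) : 1 / 2 < 1 - 3 / 2 * (1 - y x) := by linarith [(hX x hx).1]
  have hexp (x : ℝ) : Real.exp x * Real.exp (-x) = 1 := by rw [← Real.exp_add]; simp
  set v : ℝ → ℝ := fun x ↦ Real.exp x * ((1 - y x) / (1 - 3 / 2 * (1 - y x))) with hv
  have hv0 : 0 ≤ v X :=
    mul_nonneg (Real.exp_pos _).le (div_nonneg (by linarith [h.fst_lt_one X hX0])
      (by linarith [hpos X le_rfl]))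
  refine ⟨v X + Real.exp X, by positivity, fun x hx ↦ ?_⟩
  have hu1 : 0 < 1 - y x := by linarith [h.fst_lt_one x hx]
  rcases le_total X x with hXx | hxX
  · have hvx := le_of_hasDerivAt_nonpos hXx (f := v) (fun s hs ↦ by
        have hd := (h.hasDerivAt_fst s).const_sub 1
        exact (Real.hasDerivAt_exp s).mul
          (hd.div ((hd.const_mul (3 / 2)).const_sub 1) (by linarith [hpos s hs.1])))
      (fun s hs ↦ by
        have hs0 : 0 ≤ s := hX0.trans hs.1.le
        have h1 := hpos s hs.1.le
        have h2 := h.one_sub_sub_le hs0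
        set u := 1 - y s
        have e : Real.exp s * (u / (1 - 3 / 2 * u)) +
            Real.exp s * ((-p s * (1 - 3 / 2 * u) - u * -(3 / 2 * -p s)) / (1 - 3 / 2 * u) ^ 2)
            = Real.exp s * ((u - 3 / 2 * u ^ 2 - p s) / (1 - 3 / 2 * u) ^ 2) := by
          have : 1 - 3 / 2 * u ≠ 0 := by linarith
          rw [← mul_add]
          congr 1
          field_simp
          ring
        rw [e]
        exact mul_nonpos_of_nonneg_of_nonpos (Real.exp_pos _).le
          (div_nonpos_of_nonpos_of_nonneg (by linarith) (sq_nonneg _)))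
    have h3 : Real.exp x * (1 - y x) ≤ v x := by
      refine mul_le_mul_of_nonneg_left ?_ (Real.exp_pos _).le
      rw [le_div_iff₀ (by linarith [hpos x hXx])]
      nlinarith
    calc 1 - y x = Real.exp x * (1 - y x) * Real.exp (-x) := by linear_combination (-(1 - y x)) * hexp x
      _ ≤ (v X + Real.exp X) * Real.exp (-x) := by
        gcongr
        linarith [Real.exp_pos X]
  · calc 1 - y x ≤ 1 := by linarith [h.fst_nonneg hx]
      _ = Real.exp x * Real.exp (-x) := (hexp x).symm
      _ ≤ (v X + Real.exp X) * Real.exp (-x) := by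
        gcongr
        linarith [Real.exp_le_exp.2 hxX]

theorem asymptotics_atTop (h : IsProfile y p) : IntegrableOn (dIntegrand y) (Ioi 0) ∧
    (fun x : ℝ ↦ y x - (1 - BConst y * Real.exp (-x))) =O[atTop] (fun x : ℝ ↦ Real.exp (-2 * x)) := by
  obtain ⟨C, hC, hu⟩ := h.exists_one_sub_le
  have hyc := h.continuous_fst
  have hexp (x : ℝ) : Real.exp x * Real.exp (-x) = 1 := by rw [← Real.exp_add]; simp
  set G : ℝ → ℝ := fun x ↦ Real.exp x * ((p x + 2 * (1 - y x)) / 3) with hG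
  have hGd (x : ℝ) : HasDerivAt G (dIntegrand y x) x := by
    convert! (Real.hasDerivAt_exp x).mul (((h.hasDerivAt_snd x).add
      (((h.hasDerivAt_fst x).const_sub 1).const_mul 2)).div_const 3) using 1
    simp only [dIntegrand, Pi.add_apply]
    ring
  have husq (x : ℝ) (hx : 0 ≤ x) : Real.exp x * (1 - y x) ^ 2 ≤ C ^ 2 * Real.exp (-x) := by
    have h0 : 0 ≤ 1 - y x := by linarith [h.fst_lt_one x hx]
    calc Real.exp x * (1 - y x) ^ 2 ≤ Real.exp x * (C * Real.exp (-x)) ^ 2 := by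
          gcongr
          exact hu x hx
      _ = C ^ 2 * Real.exp (-x) := by linear_combination (C ^ 2 * Real.exp (-x)) * hexp x
  obtain ⟨hint, hlim⟩ := integrableOn_Ioi_and_abs_sub_le (K := C ^ 2) hGd
    (by unfold dIntegrand; fun_prop) fun x hx ↦ by
      have h0 : 0 ≤ 1 - y x := by linarith [h.fst_lt_one x hx]
      have h1 : 1 - y x ≤ 1 := by linarith [h.fst_nonneg hx]
      have h2 : 0 ≤ (1 - y x) ^ 2 - 1 / 3 * (1 - y x) ^ 3 := by
        have : 0 ≤ (1 - y x) ^ 2 * (1 - 1 / 3 * (1 - y x)) := mul_nonneg (sq_nonneg _) (by linarith)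
        linarith
      rw [dIntegrand, abs_of_nonneg (mul_nonneg (Real.exp_pos _).le h2)]
      refine le_trans ?_ (husq x hx)
      gcongr
      linarith [pow_nonneg h0 3]
  refine ⟨hint, IsBigO.of_bound (3 / 2 * C ^ 2) ?_⟩
  filter_upwards [eventually_ge_atTop 0] with x hx
  have hB : BConst y = G 0 + ∫ s in Ioi 0, dIntegrand y s := by
    simp only [BConst, aConst, dConst, h.deriv_eq, hG, h.fst_zero, Real.exp_zero]
    ring
  have h1 := hlim x hx
  rw [← hB] at h1
  have h2 := h.snd_le_one_sub hx
  have h3 := h.one_sub_sub_le hx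
  have h4 := husq x hx
  -- Splits `3(1 - y)` as the stable coordinate `p + 2(1 - y)` minus the unstable coordinate `p - (1
  -- - y)`.
  have e1 : y x - (1 - BConst y * Real.exp (-x)) =
      Real.exp (-x) * (-(G x - BConst y) + Real.exp x * (p x - (1 - y x)) / 3) := by
    simp only [hG]
    linear_combination (1 - y x) * hexp x
  have e2 : Real.exp (-2 * x) = Real.exp (-x) * Real.exp (-x) := by
    rw [← Real.exp_add]; ring_nf
  rw [Real.norm_eq_abs, Real.norm_eq_abs, abs_of_pos (Real.exp_pos (-2 * x)), e1, e2, abs_mul,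
    abs_of_pos (Real.exp_pos (-x))]
  have h5 : Real.exp x * (p x - (1 - y x)) ≤ 0 :=
    mul_nonpos_of_nonneg_of_nonpos (Real.exp_pos _).le h2
  have h6 : Real.exp x * (-(3 / 2 * (1 - y x) ^ 2)) ≤ Real.exp x * (p x - (1 - y x)) := by
    gcongr; linarith
  have h7 : |(-(G x - BConst y) + Real.exp x * (p x - (1 - y x)) / 3)| ≤
      3 / 2 * C ^ 2 * Real.exp (-x) := by
    rw [abs_le] at h1 ⊢
    constructor <;> linarith
  calc _ ≤ Real.exp (-x) * (3 / 2 * C ^ 2 * Real.exp (-x)) := by gcongr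
    _ = _ := by ring

end IsProfile

/-! ### Asymptotics at `-∞` and at `0` -/

namespace IsProfile
variable {y p : ℝ → ℝ}

theorem lyapunov_nonneg (h : IsProfile y p) {x : ℝ} (hx : x ≤ 0) : 0 ≤ lyapunov y p x := by
  have := h.sq_le x hx
  unfold lyapunov
  nlinarith [sq_nonneg (y x), sq_nonneg (p x - y x)]

theorem lyapunov_zero (h : IsProfile y p) : lyapunov y p 0 = p 0 ^ 2 / 2 := by
  simp [lyapunov, h.fst_zero]

/-- For the linear equation `e^{-x}(p² - py + y²)` is conserved. The cubic term adds `e^{-x}(2p -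
y)y³`, of no fixed sign. The factor `e^{2 lyapunov}` compensates for it, since `lyapunov` has
derivative `y²(1 - y²)` and `y² ≤ 3/10` makes the resulting quadratic form nonnegative. -/
theorem abs_fst_le (h : IsProfile y p) {x : ℝ} (hx : x ≤ 0) :
    |y x| ≤ 4 / 3 * p 0 * Real.exp (x / 2) := by
  have ha := h.slope_pos
  have ha' := h.slope_le
  have hmono := le_of_hasDerivAt_nonneg hx
    (f := fun x ↦ Real.exp (-x) * (p x ^ 2 - p x * y x + y x ^ 2) * Real.exp (2 * lyapunov y p x))
    (f' := fun x ↦ Real.exp (-x) * Real.exp (2 * lyapunov y p x) * (y x ^ 2 *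
      (2 * (p x - y x / 2) * y x + 2 * (1 - y x ^ 2) * (p x ^ 2 - p x * y x + y x ^ 2))))
    (fun x _ ↦ by
      have e1 := h.hasDerivAt_fst x
      have e2 := h.hasDerivAt_snd x
      convert! ((hasDerivAt_id x).neg.exp.mul (((e2.pow 2).sub (e2.mul e1)).add (e1.pow 2))).mul
        ((hasDerivAt_lyapunov e1 e2).const_mul 2).exp using 1
      simp only [Pi.mul_apply, Pi.add_apply, Pi.sub_apply, Pi.neg_apply, Pi.pow_apply, id]
      push_cast
      ring)
    (fun x hx ↦ by
      have h1 := h.sq_le x hx.2.le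
      refine mul_nonneg (by positivity) (mul_nonneg (sq_nonneg _) ?_)
      have h2 : 0 ≤ p x ^ 2 - p x * y x + y x ^ 2 := by nlinarith [sq_nonneg (p x - y x / 2)]
      nlinarith [sq_nonneg (p x - y x / 2 + 5 / 6 * y x), sq_nonneg (y x)])
  simp only [h.fst_zero, h.lyapunov_zero, neg_zero, Real.exp_zero] at hmono
  have hL := h.lyapunov_nonneg hx
  have h1 : 1 ≤ Real.exp (2 * lyapunov y p x) := Real.one_le_exp (by linarith)
  have h2 : Real.exp (2 * (p 0 ^ 2 / 2)) ≤ 4 / 3 := by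
    have h3 : Real.exp (2 * (p 0 ^ 2 / 2)) ≤ Real.exp (1 / 4) := Real.exp_le_exp.2 (by nlinarith)
    have h4 := Real.add_one_le_exp (-(1 / 4) : ℝ)
    have h5 : Real.exp (1 / 4) * Real.exp (-(1 / 4) : ℝ) = 1 := by rw [← Real.exp_add]; simp
    nlinarith [Real.exp_pos (1 / 4 : ℝ)]
  have h6 : 3 / 4 * y x ^ 2 ≤ p x ^ 2 - p x * y x + y x ^ 2 := by
    nlinarith [sq_nonneg (p x - y x / 2)]
  have h7 : Real.exp (-x) * (3 / 4 * y x ^ 2) ≤ p 0 ^ 2 * (4 / 3) := by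
    calc Real.exp (-x) * (3 / 4 * y x ^ 2)
        ≤ Real.exp (-x) * (p x ^ 2 - p x * y x + y x ^ 2) * 1 := by rw [mul_one]; gcongr
      _ ≤ Real.exp (-x) * (p x ^ 2 - p x * y x + y x ^ 2) * Real.exp (2 * lyapunov y p x) := by
          refine mul_le_mul_of_nonneg_left h1 (mul_nonneg (Real.exp_pos _).le ?_)
          linarith [sq_nonneg (y x)]
      _ ≤ p 0 ^ 2 * Real.exp (2 * (p 0 ^ 2 / 2)) := by linarith
      _ ≤ p 0 ^ 2 * (4 / 3) := by gcongr
  refine abs_le_of_sq_le_sq ?_ (by positivity)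
  have e1 : Real.exp (x / 2) ^ 2 = Real.exp x := by rw [← Real.exp_nat_mul]; ring_nf
  have e2 : Real.exp x * Real.exp (-x) = 1 := by rw [← Real.exp_add]; simp
  calc y x ^ 2 = 4 / 3 * (Real.exp x * (Real.exp (-x) * (3 / 4 * y x ^ 2))) := by
        linear_combination -(y x ^ 2) * e2
    _ ≤ 4 / 3 * (Real.exp x * (p 0 ^ 2 * (4 / 3))) := by gcongr
    _ = (4 / 3 * p 0 * Real.exp (x / 2)) ^ 2 := by rw [← e1]; ring

/-- The coefficient of `sin` in the variation-of-constants formula. -/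
noncomputable def sinCoeff (y p : ℝ → ℝ) (x : ℝ) : ℝ :=
  Real.exp (-x / 2) * ((p x - y x / 2) * Real.cos (√3 / 2 * x) + √3 / 2 * y x * Real.sin (√3 / 2 * x))

/-- The coefficient of `cos` in the variation-of-constants formula. -/
noncomputable def cosCoeff (y p : ℝ → ℝ) (x : ℝ) : ℝ :=
  Real.exp (-x / 2) * (√3 / 2 * y x * Real.cos (√3 / 2 * x) - (p x - y x / 2) * Real.sin (√3 / 2 * x))

theorem hasDerivAt_aux (x : ℝ) :
    HasDerivAt (fun x : ℝ ↦ Real.exp (-x / 2)) (-(1 / 2) * Real.exp (-x / 2)) x ∧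
    HasDerivAt (fun x : ℝ ↦ Real.sin (√3 / 2 * x)) (√3 / 2 * Real.cos (√3 / 2 * x)) x ∧
    HasDerivAt (fun x : ℝ ↦ Real.cos (√3 / 2 * x)) (-(√3 / 2) * Real.sin (√3 / 2 * x)) x := by
  refine ⟨?_, ?_, ?_⟩
  · convert! ((hasDerivAt_id x).neg.div_const 2).exp using 1
    simp; ring
  · convert! ((hasDerivAt_id x).const_mul (√3 / 2)).sin using 1
    simp; ring
  · convert! ((hasDerivAt_id x).const_mul (√3 / 2)).cos using 1
    simp; ring

theorem hasDerivAt_sinCoeff (h : IsProfile y p) (x : ℝ) :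
    HasDerivAt (sinCoeff y p) (bIntegrand y x) x := by
  obtain ⟨hE, hS, hC⟩ := hasDerivAt_aux x
  have e1 := h.hasDerivAt_fst x
  have e2 := h.hasDerivAt_snd x
  convert! hE.mul (((e2.sub (e1.div_const 2)).mul hC).add ((e1.const_mul (√3 / 2)).mul hS)) using 1
  have h3 : √3 ^ 2 = 3 := Real.sq_sqrt (by norm_num)
  simp only [bIntegrand, Pi.mul_apply, Pi.add_apply, Pi.sub_apply]
  linear_combination (-(1 / 4) * Real.exp (-x / 2) * Real.cos (√3 / 2 * x) * y x) * h3

theorem hasDerivAt_cosCoeff (h : IsProfile y p) (x : ℝ) :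
    HasDerivAt (fun x ↦ -cosCoeff y p x) (cIntegrand y x) x := by
  obtain ⟨hE, hS, hC⟩ := hasDerivAt_aux x
  have e1 := h.hasDerivAt_fst x
  have e2 := h.hasDerivAt_snd x
  convert! (hE.mul (((e1.const_mul (√3 / 2)).mul hC).sub ((e2.sub (e1.div_const 2)).mul hS))).neg using 1
  have h3 : √3 ^ 2 = 3 := Real.sq_sqrt (by norm_num)
  simp only [cIntegrand, Pi.mul_apply, Pi.sub_apply]
  linear_combination (-(1 / 4) * Real.exp (-x / 2) * Real.sin (√3 / 2 * x) * y x) * h3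

/-- The two coefficients are a rotation of `(p - y/2, (√3/2) y)` scaled by `e^{-x/2}`; this undoes
the rotation. -/
theorem fst_eq (y p : ℝ → ℝ) (x : ℝ) : y x = 2 / √3 * Real.exp (x / 2) *
    (sinCoeff y p x * Real.sin (√3 / 2 * x) + cosCoeff y p x * Real.cos (√3 / 2 * x)) := by
  have h1 := Real.sin_sq_add_cos_sq (√3 / 2 * x)
  have h2 : Real.exp (x / 2) * Real.exp (-x / 2) = 1 := by
    rw [← Real.exp_add, neg_div, add_neg_cancel, Real.exp_zero]
  have h3 : 2 / √3 * (√3 / 2) = 1 := by field_simp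
  have e : sinCoeff y p x * Real.sin (√3 / 2 * x) + cosCoeff y p x * Real.cos (√3 / 2 * x)
      = Real.exp (-x / 2) * (√3 / 2 * y x) := by
    unfold sinCoeff cosCoeff
    linear_combination (Real.exp (-x / 2) * (√3 / 2 * y x)) * h1
  rw [e]
  linear_combination (-(y x) * (2 / √3) * (√3 / 2)) * h2 - y x * h3

theorem exp_mul_cube_le (h : IsProfile y p) {x : ℝ} (hx : x ≤ 0) :
    Real.exp (-x / 2) * |y x ^ 3| ≤ 4 / 3 * p 0 * y x ^ 2 := by
  have h2 : Real.exp (x / 2) * Real.exp (-x / 2) = 1 := by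
    rw [← Real.exp_add, neg_div, add_neg_cancel, Real.exp_zero]
  calc Real.exp (-x / 2) * |y x ^ 3| = Real.exp (-x / 2) * (|y x| * y x ^ 2) := by
        rw [abs_pow, ← sq_abs (y x)]; ring
    _ ≤ Real.exp (-x / 2) * (4 / 3 * p 0 * Real.exp (x / 2) * y x ^ 2) := by
        gcongr
        exact h.abs_fst_le hx
    _ = 4 / 3 * p 0 * y x ^ 2 := by linear_combination (4 / 3 * p 0 * y x ^ 2) * h2

theorem exp_mul_cube_le_exp (h : IsProfile y p) {x : ℝ} (hx : x ≤ 0) :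
    Real.exp (-x / 2) * |y x ^ 3| ≤ (4 / 3 * p 0) ^ 3 * Real.exp x := by
  have ha := h.slope_pos
  have e1 : Real.exp (x / 2) ^ 2 = Real.exp x := by rw [← Real.exp_nat_mul]; ring_nf
  calc Real.exp (-x / 2) * |y x ^ 3| ≤ 4 / 3 * p 0 * y x ^ 2 := h.exp_mul_cube_le hx
    _ ≤ 4 / 3 * p 0 * (4 / 3 * p 0 * Real.exp (x / 2)) ^ 2 := by
        rw [← sq_abs (y x)]
        gcongr
        exact h.abs_fst_le hx
    _ = (4 / 3 * p 0) ^ 3 * Real.exp x := by rw [← e1]; ring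

/-- The Lyapunov function pays for the drift. The derivative `bIntegrand` is at most `(4/3) p(0)
y²`, hence at most `2 p(0) y²(1 - y²)`, the derivative of `2 p(0) lyapunov`. The total loss is
therefore at most `p(0)³ ≤ p(0)/4`. The bound is uniform in `x`, so it survives the limit `x → -∞`.
-/
theorem le_sinCoeff (h : IsProfile y p) {x : ℝ} (hx : x ≤ 0) : 3 / 4 * p 0 ≤ sinCoeff y p x := by
  have ha := h.slope_pos
  have ha' := h.slope_le
  have := le_of_hasDerivAt_nonpos hx
    (f := fun x ↦ sinCoeff y p x - 2 * p 0 * lyapunov y p x)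
    (fun x _ ↦ (h.hasDerivAt_sinCoeff x).sub
      ((hasDerivAt_lyapunov (h.hasDerivAt_fst x) (h.hasDerivAt_snd x)).const_mul (2 * p 0)))
    (fun x hx ↦ by
      have h1 := h.sq_le x hx.2.le
      have h2 := h.exp_mul_cube_le hx.2.le
      have h3 : bIntegrand y x ≤ Real.exp (-x / 2) * |y x ^ 3| := by
        refine (le_abs_self _).trans ?_
        rw [bIntegrand, abs_mul, abs_mul, Real.abs_exp]
        gcongr
        exact mul_le_of_le_one_right (Real.exp_pos _).le (Real.abs_cos_le_one _)
      have h4 : p 0 * y x ^ 2 * (2 / 3) ≤ p 0 * y x ^ 2 * (1 - y x ^ 2) := by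
        gcongr; linarith
      linarith)
  simp only [h.lyapunov_zero] at this
  have h0 : sinCoeff y p 0 = p 0 := by simp [sinCoeff, h.fst_zero]
  have h1 : 0 ≤ p 0 * lyapunov y p x := mul_nonneg ha.le (h.lyapunov_nonneg hx)
  rw [h0] at this
  have h2 : p 0 * p 0 ^ 2 ≤ p 0 * (1 / 4) := by gcongr; nlinarith
  linarith

theorem asymptotics_atBot (h : IsProfile y p) :
    IntegrableOn (bIntegrand y) (Iic 0) ∧ IntegrableOn (cIntegrand y) (Iic 0) ∧
    0 < aConst y - bConst y ∧
    (fun x : ℝ ↦ y x -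
        amplitude y * Real.exp (x / 2) * Real.sin (√3 / 2 * x + phase y))
      =O[atBot] (fun x : ℝ ↦ Real.exp (3 * x / 2)) := by
  have ha := h.slope_pos
  have hyc := h.continuous_fst
  set K := (4 / 3 * p 0) ^ 3 with hK
  obtain ⟨hbi, hb⟩ := integrableOn_Iic_and_abs_sub_le (K := K) h.hasDerivAt_sinCoeff
    (by unfold bIntegrand; fun_prop) fun x hx ↦ by
      refine le_trans ?_ (h.exp_mul_cube_le_exp hx)
      rw [bIntegrand, abs_mul, abs_mul, Real.abs_exp]
      gcongr
      exact mul_le_of_le_one_right (Real.exp_pos _).le (Real.abs_cos_le_one _)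
  obtain ⟨hci, hc⟩ := integrableOn_Iic_and_abs_sub_le (K := K) h.hasDerivAt_cosCoeff
    (by unfold cIntegrand; fun_prop) fun x hx ↦ by
      refine le_trans ?_ (h.exp_mul_cube_le_exp hx)
      rw [cIntegrand, abs_mul, abs_mul, Real.abs_exp]
      gcongr
      exact mul_le_of_le_one_right (Real.exp_pos _).le (Real.abs_sin_le_one _)
  have hb0 : sinCoeff y p 0 - ∫ s in Iic 0, bIntegrand y s = aConst y - bConst y := by
    simp [sinCoeff, h.fst_zero, aConst, bConst, h.deriv_eq]
  have hc0 : -cosCoeff y p 0 - ∫ s in Iic 0, cIntegrand y s = -cConst y := by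
    simp [cosCoeff, h.fst_zero, cConst]
  rw [hb0] at hb
  simp only [hc0] at hc
  have hpos : 0 < aConst y - bConst y := by
    have hlim : Tendsto (fun x ↦ aConst y - bConst y + K * Real.exp x) atBot
        (𝓝 (aConst y - bConst y + K * 0)) :=
      (Real.tendsto_exp_atBot.const_mul K).const_add _
    have : 3 / 4 * p 0 ≤ aConst y - bConst y + K * 0 := by
      refine ge_of_tendsto hlim ?_
      filter_upwards [eventually_le_atBot 0] with x hx
      linarith [h.le_sinCoeff hx, (abs_le.1 (hb x hx)).2]
    linarith
  refine ⟨hbi, hci, hpos, IsBigO.of_bound (2 / √3 * (2 * K)) ?_⟩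
  filter_upwards [eventually_le_atBot 0] with x hx
  have hbx := hb x hx
  have hcx := hc x hx
  set α := aConst y - bConst y with hα
  set c := cConst y with hcc
  have hphase : amplitude y * Real.sin (√3 / 2 * x + phase y)
      = 2 / √3 * (α * Real.sin (√3 / 2 * x) + c * Real.cos (√3 / 2 * x)) := by
    -- Pulling `α` out of the root without an absolute value needs `α > 0`, not merely `α ≠ 0`.
    have e : √(α ^ 2 + c ^ 2) = α * √(1 + (c / α) ^ 2) := by
      rw [← Real.sqrt_sq hpos.le, ← Real.sqrt_mul (sq_nonneg _), Real.sqrt_sq hpos.le]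
      congr 1
      field_simp
    have hr : 0 < √(1 + (c / α) ^ 2) := Real.sqrt_pos.2 (by positivity)
    rw [amplitude, phase, ← hα, ← hcc, e, Real.sin_add, Real.sin_arctan, Real.cos_arctan]
    field_simp
  have e1 : y x - amplitude y * Real.exp (x / 2) * Real.sin (√3 / 2 * x + phase y) =
      2 / √3 * Real.exp (x / 2) * ((sinCoeff y p x - α) * Real.sin (√3 / 2 * x) -
        (-cosCoeff y p x - -c) * Real.cos (√3 / 2 * x)) := by
    linear_combination fst_eq y p x - Real.exp (x / 2) * hphase
  have e2 : Real.exp (3 * x / 2) = Real.exp (x / 2) * Real.exp x := by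
    rw [← Real.exp_add]; ring_nf
  have h1 : |(sinCoeff y p x - α) * Real.sin (√3 / 2 * x) -
        (-cosCoeff y p x - -c) * Real.cos (√3 / 2 * x)| ≤ 2 * K * Real.exp x := by
    refine (abs_sub _ _).trans ?_
    rw [abs_mul, abs_mul]
    have := mul_le_of_le_one_right (abs_nonneg (sinCoeff y p x - α))
      (Real.abs_sin_le_one (√3 / 2 * x))
    have := mul_le_of_le_one_right (abs_nonneg (-cosCoeff y p x - -c))
      (Real.abs_cos_le_one (√3 / 2 * x))
    linarith
  rw [Real.norm_eq_abs, Real.norm_eq_abs, Real.abs_exp, e1, e2, abs_mul,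
    abs_of_pos (by positivity : 0 < 2 / √3 * Real.exp (x / 2))]
  calc _ ≤ 2 / √3 * Real.exp (x / 2) * (2 * K * Real.exp x) := by gcongr
    _ = _ := by ring

theorem isEquivalent_zero (h : IsProfile y p) : y ~[𝓝 0] (fun x : ℝ ↦ aConst y * x) := by
  have ha : aConst y ≠ 0 := by rw [aConst, h.deriv_eq]; exact h.slope_pos.ne'
  have h1 := (h.hasDerivAt_fst 0).isLittleO
  simp only [h.fst_zero, sub_zero, smul_eq_mul] at h1
  have h2 : (fun x : ℝ ↦ x) =O[𝓝 0] fun x ↦ aConst y * x :=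
    (isBigO_const_mul_self (aConst y)⁻¹ (fun x ↦ aConst y * x) _).congr_left fun x ↦ by field_simp
  refine IsLittleO.trans_isBigO (h1.congr_left fun x ↦ ?_) h2
  simp [aConst, h.deriv_eq, mul_comm]

end IsProfile

theorem theorem4 :
    (∃! y : ℝ → ℝ, IsSolutionP y) ∧
    ∀ y : ℝ → ℝ, IsSolutionP y →
      -- the integrals defining `b`, `c`, `d` converge, and the quotient in `φ` is defined
      IntegrableOn (bIntegrand y) (Iic 0) ∧
      IntegrableOn (cIntegrand y) (Iic 0) ∧
      IntegrableOn (dIntegrand y) (Ioi 0) ∧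
      aConst y - bConst y ≠ 0 ∧
      -- (i) as `x → -∞`
      (fun x : ℝ => y x -
          amplitude y * Real.exp (x / 2) * Real.sin (Real.sqrt 3 / 2 * x + phase y))
        =O[atBot] (fun x : ℝ => Real.exp (3 * x / 2)) ∧
      -- (ii) as `x → 0`; the linear coefficient does not vanish
      aConst y ≠ 0 ∧
      y ~[𝓝 0] (fun x : ℝ => aConst y * x) ∧
      -- (iii) as `x → ∞`
      (fun x : ℝ => y x - (1 - BConst y * Real.exp (-x)))
        =O[atTop] (fun x : ℝ => Real.exp (-2 * x)) := by
  obtain ⟨z, p, h⟩ := exists_isProfile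
  refine ⟨⟨z, h.isSolutionP, fun y hy ↦ hy.unique h.isSolutionP⟩, fun y hy ↦ ?_⟩
  obtain rfl : z = y := h.isSolutionP.unique hy
  obtain ⟨hb, hc, hab, hbot⟩ := h.asymptotics_atBot
  obtain ⟨hd, htop⟩ := h.asymptotics_atTop
  have ha : aConst z ≠ 0 := by rw [aConst, h.deriv_eq]; exact h.slope_pos.ne'
  exact ⟨hb, hc, hd, hab.ne', hbot, ha, h.isEquivalent_zero, htop⟩
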